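/- \textbf{Setting.} Let $A\in\mathbb{C}^{N\times N}$ be positive semidefinite, with eigenvalues $\lambda_1(A)\ge\dots\ge\lambda_N(A)\ge 0$, and let $b\ge 1$ be an integer (the block size). For a psd matrix $R$ and a set $S$ of indices write $$R/S := R - R(:,S)\,R(S,S)^{\dagger}\,R(S,:),$$ where $\dagger$ is the Moore--Penrose pseudoinverse (so $R/\emptyset=R$). Put $A^{(0)}=A$. Given the residual $R=A^{(i)}$, one round of each method draws proposals $s_1',\dots,s_b'$ independently with $\mathbb{P}\{s'_\ell=j\}=R(j,j)/\operatorname{tr}R$, and then: \emph{Block RPCholesky} sets $A^{(i+1)}=R/\{s_1',\dots,s_b'\}$. \emph{Accelerated RPCholesky} starts from $S=\emptyset$ and, for $\ell=1,\dots,b$ in order, accepts $s_\ell'$ (replacing $S$ by $S\cup\{s_\ell'\}$) with probability $(R/S)(s_\ell',s_\ell')/R(s_\ell',s_\ell')$, and otherwise leaves $S$ unchanged; then $A^{(i+1)}=R/S$ with the final $S$. If $R=0$, no pivot can be drawn and $A^{(i+1)}=0$. \textbf{Theorem (Sufficient iterations for accelerated and block RPCholesky).} Let $A^{(t)}$ be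 the random residual after $t\ge 0$ rounds of either accelerated RPCholesky or block RPCholesky with block size $b$. Let $r\ge 0$ be an integer with $\sum_{i>r}\lambda_i(A)>0$, and let $\varepsilon>0$. Then $$\mathbb{E}\bigl[\operatorname{tr}A^{(t)}\bigr]\le(1+\varepsilon)\sum_{i=r+1}^{N}\lambda_i(A)$$ as soon as the number $bt$ of proposed pivots satisfies $$bt\ \ge\ \frac{r}{\varepsilon}+(r+b)\,\log\Bigl(\frac{1}{\varepsilon\eta}\Bigr),\qquad \eta=\frac{\sum_{i=r+1}^{N}\lambda_i(A)}{\sum_{i=1}^{r}\lambda_i(A)}.$$ (For $r=0$, where $\eta=+\infty$, the condition on $bt$ counts as satisfied for every $t\ge 0$.) -/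

import Mathlib

open scoped ENNReal NNReal ComplexOrder Matrix

namespace RPCholesky

noncomputable section

variable {n : Type*} [Fintype n] [DecidableEq n]

/-- The pseudoinverse of a Hermitian matrix: in a spectral decomposition every nonzero eigenvalue
is inverted and the eigenvalue zero is kept (`0⁻¹ = 0`).  The lemma `pinv_isMoorePenrose` below
checks that this is the Moore-Penrose pseudoinverse. -/
def pinv (H : Matrix n n ℂ) : Matrix n n ℂ :=
  cfc (fun x : ℝ => x⁻¹) H

/-- The four Penrose conditions, which characterize the Moore-Penrose pseudoinverse. -/
theorem pinv_isMoorePenrose (H : Matrix n n ℂ) (hH : H.IsHermitian) :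
    H * pinv H * H = H ∧ pinv H * H * pinv H = pinv H ∧
      (H * pinv H).IsHermitian ∧ (pinv H * H).IsHermitian := by
  have hc : ∀ f : ℝ → ℝ, ContinuousOn f (spectrum ℝ H) := fun f =>
    (Matrix.finite_real_spectrum (A := H)).continuousOn f
  have hs : IsSelfAdjoint H := hH
  have hid : cfc (fun x : ℝ => x) H = H := cfc_id' ℝ H
  have h1 : H * pinv H = cfc (fun x : ℝ => x * x⁻¹) H := by
    rw [cfc_mul _ _ H (hc _) (hc _), hid]; rfl
  have h2 : pinv H * H = cfc (fun x : ℝ => x⁻¹ * x) H := by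
    rw [cfc_mul _ _ H (hc _) (hc _), hid]; rfl
  refine ⟨?_, ?_, ?_, ?_⟩
  · have h3 : cfc (fun x : ℝ => x * x⁻¹ * x) H = H * pinv H * H := by
      rw [cfc_mul (fun x : ℝ => x * x⁻¹) _ H (hc _) (hc _), hid, h1]
    rw [← h3]
    simp only [mul_inv_mul_cancel, hid]
  · have h3 : cfc (fun x : ℝ => x⁻¹ * x * x⁻¹) H = pinv H * H * pinv H := by
      rw [cfc_mul (fun x : ℝ => x⁻¹ * x) _ H (hc _) (hc _), h2]; rfl
    rw [← h3]
    have h4 : (fun x : ℝ => x⁻¹ * x * x⁻¹) = fun x => x⁻¹ := by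
      funext x
      by_cases hx : x = 0 <;> simp [hx]
    rw [h4]; rfl
  · rw [h1]; exact cfc_predicate (p := IsSelfAdjoint) _ H
  · rw [h2]; exact cfc_predicate (p := IsSelfAdjoint) _ H

/-- The residual `A - A(:,S) A(S,S)† A(S,:)` of the partial Cholesky approximation of `A` with
pivot set `S`. -/
def cholResidual (A : Matrix n n ℂ) (S : Finset n) : Matrix n n ℂ :=
  A - A.submatrix id (fun s : S => (s : n)) *
      pinv (A.submatrix (fun s : S => (s : n)) (fun s : S => (s : n))) *
      A.submatrix (fun s : S => (s : n)) id

/-- The diagonal of `R`, as a family of nonnegative weights. -/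
def diagWeight (R : Matrix n n ℂ) (j : n) : ℝ≥0∞ :=
  ENNReal.ofReal (R j j).re

/-- The pivot distribution `P(s = j) = R(j,j) / tr R`, for a psd matrix `R` with nonzero
diagonal. -/
def pivotLaw (R : Matrix n n ℂ) (hR : ∑' j, diagWeight R j ≠ 0) : PMF n :=
  PMF.normalize (diagWeight R) hR (by
    rw [tsum_fintype]
    exact ENNReal.sum_ne_top.2 fun j _ => ENNReal.ofReal_ne_top)

/-- The law of a list of `k` independent draws from `p`. -/
def iidDraws {α : Type*} (p : PMF α) : ℕ → PMF (List α)
  | 0 => PMF.pure []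
  | k + 1 => p.bind fun s => (iidDraws p k).map fun l => s :: l

/-- The probability of accepting the proposal `s`, given the set `S` of the pivots accepted so far
in the current round, which started from the residual `R`:
`(R(s,s) - R(s,S) R(S,S)† R(S,s)) / R(s,s)`.  For psd `R` this ratio lies in `[0,1]`, and the
truncation is void. -/
def acceptProb (R : Matrix n n ℂ) (S : Finset n) (s : n) : ℝ≥0 :=
  min 1 (Real.toNNReal ((cholResidual R S s s).re / (R s s).re))

/-- The law of a coin that shows `true` with probability `p`. -/
def coin (p : ℝ≥0) (hp : p ≤ 1) : PMF Bool :=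
  PMF.ofFintype (fun a => if a then (p : ℝ≥0∞) else ((1 - p : ℝ≥0) : ℝ≥0∞)) (by
    rw [Fintype.sum_bool]
    simp only [if_true, Bool.false_eq_true, if_false]
    rw [← ENNReal.coe_add, add_tsub_cancel_of_le hp, ENNReal.coe_one])

/-- Rejection sampling: the proposals in the list are processed in order, each being accepted with
the probability `acceptProb`, independently of everything else given the pivots accepted before.
The result is the law of the set of accepted pivots, `S` being the set accepted so far. -/
def rejectionSample (R : Matrix n n ℂ) : List n → Finset n → PMF (Finset n)
  | [], S => PMF.pure S
  | s :: l, S =>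
      (coin (acceptProb R S s) (min_le_left _ _)).bind fun accepted =>
        rejectionSample R l (if accepted then insert s S else S)

open scoped Classical in
/-- One round of accelerated RPCholesky with block size `b`, from the residual `R`: the law of the
next residual.  If the diagonal of `R` vanishes (for psd `R`: if `R = 0`), no pivot can be drawn,
and the residual is kept. -/
def acceleratedRound (b : ℕ) (R : Matrix n n ℂ) : PMF (Matrix n n ℂ) :=
  if hR : ∑' j, diagWeight R j ≠ 0 then
    (iidDraws (pivotLaw R hR) b).bind fun proposals =>
      (rejectionSample R proposals ∅).map fun S => cholResidual R S
  else PMF.pure R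

open scoped Classical in
/-- One round of block RPCholesky with block size `b`, from the residual `R`: all the proposals are
accepted, without repetition. -/
def blockRound (b : ℕ) (R : Matrix n n ℂ) : PMF (Matrix n n ℂ) :=
  if hR : ∑' j, diagWeight R j ≠ 0 then
    (iidDraws (pivotLaw R hR) b).map fun proposals => cholResidual R proposals.toFinset
  else PMF.pure R

/-- The law of the residual `A^(t)` after `t` rounds of accelerated RPCholesky. -/
def acceleratedLaw (A : Matrix n n ℂ) (b : ℕ) : ℕ → PMF (Matrix n n ℂ)
  | 0 => PMF.pure A
  | t + 1 => (acceleratedLaw A b t).bind (acceleratedRound b)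

/-- The law of the residual `A^(t)` after `t` rounds of block RPCholesky. -/
def blockLaw (A : Matrix n n ℂ) (b : ℕ) : ℕ → PMF (Matrix n n ℂ)
  | 0 => PMF.pure A
  | t + 1 => (blockLaw A b t).bind (blockRound b)

/-- The random variable `tr M` has a finite expectation when `M` has law `p`. -/
def TraceIntegrable (p : PMF (Matrix n n ℂ)) : Prop :=
  Summable fun M : Matrix n n ℂ => (p M).toReal * M.trace.re

/-- The expectation `E[tr M]` of the (real) trace of a random Hermitian matrix `M` with discrete
law `p`. -/
def expectedTrace (p : PMF (Matrix n n ℂ)) : ℝ :=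
  ∑' M : Matrix n n ℂ, (p M).toReal * M.trace.re

/-- The sum of the `r` largest eigenvalues, with multiplicity (`eigenvalues₀` lists the eigenvalues
in decreasing order, with indices from zero). -/
def headSum {A : Matrix n n ℂ} (hA : A.IsHermitian) (r : ℕ) : ℝ :=
  ∑ i ∈ Finset.univ.filter (fun i : Fin (Fintype.card n) => (i : ℕ) < r), hA.eigenvalues₀ i

/-- The sum of all the eigenvalues but the `r` largest, with multiplicity. -/
def tailSum {A : Matrix n n ℂ} (hA : A.IsHermitian) (r : ℕ) : ℝ :=
  ∑ i ∈ Finset.univ.filter (fun i : Fin (Fintype.card n) => r ≤ (i : ℕ)), hA.eigenvalues₀ i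

end

end RPCholesky

/-!
The spectral bound is reduced to a recursion for one real number.

Let `u₁, …, u_N` be orthonormal eigenvectors of `A`, belonging to decreasing eigenvalues, and let
`x(R) = ∑_{i ≤ r} u_i* R u_i` be the partial trace of a residual `R` over the leading `r` of them.
The residual `R/S` is the generalized Schur complement, and its quadratic form at `v` is the
minimum of the quadratic form of `R` on `v + span {e_s : s ∈ S}` (`quadForm_cholResidual_le`,
`exists_quadForm_cholResidual_eq`).  Hence residuals are psd and decrease when pivots are added,
and accepting one more pivot `s` lowers the form at `v` by at least `|(M v)_s|² / M(s,s)`, where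
`M = R/S` (`diag_mul_quadForm_insert_le`).

Within a round of accelerated RPCholesky that starts from `R`, rejection turns the probability of
accepting `s` into `M(s,s) / tr R` (`expect_proposal`).  So one proposal lowers the mean of `x` by
at least `∑_{i ≤ r} ‖M u_i‖² / tr R ≥ x² / C` with `C = r tr R`, by the Cauchy-Schwarz inequality.
As `x - x² / C ≤ x C / (C + x)` and `x ↦ x C / (C + k x)` is concave and increasing, `b` proposals
bring the mean of `x` to at most `x C / (C + b x)` (`expect_rejectionSample_le`).  Block RPCholesky
keeps a superset of the pivots, and inherits the bound.

Over all the rounds the trailing partial trace never exceeds its initial value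
`β = ∑_{i > r} λ_i(A)`, whence `tr R ≤ x + β`.  Concavity gives, for the means `x_t`, the recursion
`x_{t+1} ≤ g(x_t)` with `g(x) = x r (x + β) / (r (x + β) + b x)`
(`IsDecayingRound.expect_partialTrace_succ_le`).  The potential `(r + b) log x - r β / x` drops by
at least `b` under `g` (`potential_roundMap_le`), which forces `x_t ≤ ε β` once `b t` is as large
as assumed (`recursion_le`).
-/

namespace RPCholesky

/-! ### Expectations under finitely supported laws -/

section Expectation

variable {α β : Type*}

/-- The expectation of the real random variable `f` under the discrete law `p`.  The series is
a finite sum, hence meaningful, for every law of finite support. -/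
noncomputable def expect (p : PMF α) (f : α → ℝ) : ℝ :=
  ∑' a, (p a).toReal * f a

theorem toReal_apply_eq_zero {p : PMF α} {a : α} (h : a ∉ p.support) : (p a).toReal = 0 := by
  rw [(p.apply_eq_zero_iff a).2 h, ENNReal.toReal_zero]

theorem expect_eq_sum {p : PMF α} {F : Finset α} (h : p.support ⊆ F) (f : α → ℝ) :
    expect p f = ∑ a ∈ F, (p a).toReal * f a :=
  tsum_eq_sum fun a ha => by rw [toReal_apply_eq_zero fun h' => ha (h h'), zero_mul]

theorem summable_of_finite_support {p : PMF α} (hp : p.support.Finite) (f : α → ℝ) :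
    Summable fun a => (p a).toReal * f a :=
  summable_of_ne_finset_zero (s := hp.toFinset) fun a ha => by
    rw [toReal_apply_eq_zero fun h' => ha (hp.mem_toFinset.2 h'), zero_mul]

theorem sum_toReal_eq_one {p : PMF α} {F : Finset α} (h : p.support ⊆ F) :
    ∑ a ∈ F, (p a).toReal = 1 := by
  rw [← ENNReal.toReal_sum fun a _ => p.apply_ne_top a]
  have : ∑ a ∈ F, p a = 1 := by
    rw [← p.tsum_coe]
    exact (tsum_eq_sum fun a ha => (p.apply_eq_zero_iff a).2 fun h' => ha (h h')).symm
  rw [this, ENNReal.toReal_one]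

theorem expect_mono {p : PMF α} (hp : p.support.Finite) {f g : α → ℝ}
    (h : ∀ a ∈ p.support, f a ≤ g a) : expect p f ≤ expect p g := by
  rw [expect_eq_sum hp.coe_toFinset.ge, expect_eq_sum hp.coe_toFinset.ge]
  exact Finset.sum_le_sum fun a ha =>
    mul_le_mul_of_nonneg_left (h a (hp.mem_toFinset.1 ha)) ENNReal.toReal_nonneg

theorem expect_affine {p : PMF α} (hp : p.support.Finite) (f : α → ℝ) (c d : ℝ) :
    expect p (fun a => c * f a + d) = c * expect p f + d := by
  simp only [expect_eq_sum hp.coe_toFinset.ge]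
  rw [Finset.mul_sum]
  conv_rhs => rw [← mul_one d, ← sum_toReal_eq_one hp.coe_toFinset.ge, Finset.mul_sum]
  rw [← Finset.sum_add_distrib]
  exact Finset.sum_congr rfl fun a _ => by ring

theorem expect_add {p : PMF α} (hp : p.support.Finite) (f g : α → ℝ) :
    expect p (fun a => f a + g a) = expect p f + expect p g := by
  simp only [expect_eq_sum hp.coe_toFinset.ge, ← Finset.sum_add_distrib, mul_add]

theorem expect_const {p : PMF α} (hp : p.support.Finite) (d : ℝ) :
    expect p (fun _ => d) = d := by
  simpa using expect_affine hp (fun _ => (0 : ℝ)) 0 d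

theorem expect_nonneg {p : PMF α} {f : α → ℝ} (h : ∀ a ∈ p.support, 0 ≤ f a) :
    0 ≤ expect p f :=
  tsum_nonneg fun a => by
    by_cases ha : a ∈ p.support
    · exact mul_nonneg ENNReal.toReal_nonneg (h a ha)
    · rw [toReal_apply_eq_zero ha, zero_mul]

theorem expect_pure (a : α) (f : α → ℝ) : expect (PMF.pure a) f = f a := by
  rw [expect_eq_sum (F := {a}) (by simp)]
  simp

theorem finite_support_bind {p : PMF α} (hp : p.support.Finite) {K : α → PMF β}
    (hK : ∀ a ∈ p.support, (K a).support.Finite) : (p.bind K).support.Finite := by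
  rw [PMF.support_bind]
  exact hp.biUnion hK

theorem expect_bind {p : PMF α} (hp : p.support.Finite) {K : α → PMF β}
    (hK : ∀ a ∈ p.support, (K a).support.Finite) (f : β → ℝ) :
    expect (p.bind K) f = expect p fun a => expect (K a) f := by
  have hb := finite_support_bind hp hK
  rw [expect_eq_sum hb.coe_toFinset.ge, expect_eq_sum hp.coe_toFinset.ge]
  have h1 : ∀ y, ((p.bind K) y).toReal = ∑ a ∈ hp.toFinset, (p a).toReal * (K a y).toReal := by
    intro y
    rw [PMF.bind_apply, tsum_eq_sum (s := hp.toFinset), ENNReal.toReal_sum]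
    · simp only [ENNReal.toReal_mul]
    · exact fun a _ => ENNReal.mul_ne_top (p.apply_ne_top a) ((K a).apply_ne_top y)
    · intro a ha
      rw [(p.apply_eq_zero_iff a).2 fun h' => ha (hp.mem_toFinset.2 h'), zero_mul]
  simp only [h1, Finset.sum_mul]
  rw [Finset.sum_comm]
  refine Finset.sum_congr rfl fun a ha => ?_
  have hsub : (K a).support ⊆ hb.toFinset := fun y hy =>
    hb.mem_toFinset.2 ((PMF.mem_support_bind_iff _ _ _).2 ⟨a, hp.mem_toFinset.1 ha, hy⟩)
  rw [expect_eq_sum hsub, Finset.mul_sum]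
  exact Finset.sum_congr rfl fun y _ => mul_assoc _ _ _

theorem finite_support_map {p : PMF α} (hp : p.support.Finite) (g : α → β) :
    (p.map g).support.Finite := by
  rw [PMF.support_map]
  exact hp.image g

theorem expect_map {p : PMF α} (hp : p.support.Finite) (g : α → β) (f : β → ℝ) :
    expect (p.map g) f = expect p fun a => f (g a) := by
  rw [← PMF.bind_pure_comp, expect_bind hp fun a _ => by simp]
  simp only [Function.comp_apply, expect_pure]

theorem finite_support_iidDraws [Finite α] (p : PMF α) (k : ℕ) :
    (iidDraws p k).support.Finite := by
  induction k with
  | zero => simp [iidDraws]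
  | succ k ih =>
    exact finite_support_bind (Set.toFinite _) fun a _ => finite_support_map ih _

theorem expect_iidDraws_succ [Finite α] (p : PMF α) (k : ℕ) (f : List α → ℝ) :
    expect (iidDraws p (k + 1)) f =
      expect p fun s => expect (iidDraws p k) fun l => f (s :: l) := by
  rw [iidDraws, expect_bind (Set.toFinite _) fun a _ =>
    finite_support_map (finite_support_iidDraws p k) _]
  simp only [expect_map (finite_support_iidDraws p k)]

theorem expect_coin (p : ℝ≥0) (hp : p ≤ 1) (f : Bool → ℝ) :
    expect (coin p hp) f = (p : ℝ) * f true + (1 - (p : ℝ)) * f false := by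
  rw [expect, tsum_fintype, Fintype.sum_bool]
  simp [coin, PMF.ofFintype_apply, ENNReal.toReal_sub_of_le, hp]

end Expectation

/-! ### Residuals as constrained minima of the quadratic form -/

section Coordinates

variable {n : Type*}

theorem re_diag_nonneg {M : Matrix n n ℂ} (hM : M.PosSemidef) (s : n) : 0 ≤ (M s s).re :=
  (Complex.le_def.1 hM.diag_nonneg).1

variable [DecidableEq n]

/-- The inclusion of the coordinate subspace spanned by `S`. -/
def coordInclusion (S : Finset n) : Matrix n S ℂ :=
  (1 : Matrix n n ℂ).submatrix id (fun s : S => (s : n))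

theorem coordInclusion_mulVec_apply_of_notMem {S : Finset n} (z : S → ℂ) {i : n} (hi : i ∉ S) :
    (coordInclusion S *ᵥ z) i = 0 := by
  rw [Matrix.mulVec, dotProduct]
  refine Finset.sum_eq_zero fun s _ => ?_
  rw [coordInclusion, Matrix.submatrix_apply, id, Matrix.one_apply_ne, zero_mul]
  rintro rfl
  exact hi s.2

theorem coordInclusion_mulVec_restrict {S : Finset n} {w : n → ℂ} (hw : ∀ i ∉ S, w i = 0) :
    coordInclusion S *ᵥ (fun s : S => w s) = w := by
  funext i
  rw [Matrix.mulVec, dotProduct]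
  simp only [coordInclusion, Matrix.submatrix_apply, id, Matrix.one_apply]
  rw [Finset.sum_coe_sort S (fun s => (if i = s then (1 : ℂ) else 0) * w s)]
  by_cases hi : i ∈ S
  · simp [hi]
  · simp [hi, hw i hi]

end Coordinates

section LinearAlgebra

variable {n m : Type*} [Fintype n] [Fintype m]

/-- The real part of the quadratic form `v ↦ v* R v`. -/
def quadForm (R : Matrix n n ℂ) (v : n → ℂ) : ℝ :=
  (star v ⬝ᵥ R *ᵥ v).re

theorem quadForm_nonneg {R : Matrix n n ℂ} (hR : R.PosSemidef) (v : n → ℂ) : 0 ≤ quadForm R v :=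
  (Complex.le_def.1 (hR.dotProduct_mulVec_nonneg v)).1

theorem quadForm_conjTranspose_mul_mul (R : Matrix n n ℂ) (Q : Matrix n m ℂ) (v : m → ℂ) :
    quadForm (Qᴴ * R * Q) v = quadForm R (Q *ᵥ v) := by
  simp only [quadForm, Matrix.star_mulVec, ← Matrix.dotProduct_mulVec, Matrix.mulVec_mulVec]
  rw [← Matrix.mul_assoc]

theorem quadForm_add {R : Matrix n n ℂ} (hR : R.IsHermitian) (v w : n → ℂ) :
    quadForm R (v + w) = quadForm R v + quadForm R w + 2 * (star w ⬝ᵥ R *ᵥ v).re := by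
  have h : star v ⬝ᵥ R *ᵥ w = star (star w ⬝ᵥ R *ᵥ v) := by
    rw [Matrix.star_dotProduct, Matrix.star_mulVec, hR.eq, ← Matrix.dotProduct_mulVec]
  simp only [quadForm, star_add, Matrix.mulVec_add, dotProduct_add, add_dotProduct, h]
  simp
  ring

theorem quadForm_sq_le (M : Matrix n n ℂ) {v : n → ℂ} (hv : star v ⬝ᵥ v = 1) :
    quadForm M v ^ 2 ≤ ∑ s, ‖(M *ᵥ v) s‖ ^ 2 := by
  have h := norm_inner_le_norm (𝕜 := ℂ) (WithLp.toLp 2 v : EuclideanSpace ℂ n)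
    (WithLp.toLp 2 (M *ᵥ v))
  rw [EuclideanSpace.inner_toLp_toLp, dotProduct_comm] at h
  have hn : ‖(WithLp.toLp 2 v : EuclideanSpace ℂ n)‖ = 1 := by
    have h1 := inner_self_eq_norm_sq_to_K (𝕜 := ℂ) (WithLp.toLp 2 v : EuclideanSpace ℂ n)
    rw [EuclideanSpace.inner_toLp_toLp, dotProduct_comm, hv] at h1
    have h2 : ‖(WithLp.toLp 2 v : EuclideanSpace ℂ n)‖ ^ 2 = 1 := by
      exact Complex.ofReal_injective (by rw [Complex.ofReal_pow, Complex.ofReal_one]; exact h1.symm)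
    exact (pow_eq_one_iff_of_nonneg (norm_nonneg _) two_ne_zero).1 h2
  rw [hn, one_mul] at h
  calc quadForm M v ^ 2 ≤ ‖star v ⬝ᵥ M *ᵥ v‖ ^ 2 := by
        rw [← sq_abs]
        exact pow_le_pow_left₀ (abs_nonneg _) (Complex.abs_re_le_norm _) 2
    _ ≤ ‖(WithLp.toLp 2 (M *ᵥ v) : EuclideanSpace ℂ n)‖ ^ 2 :=
        pow_le_pow_left₀ (norm_nonneg _) h 2
    _ = _ := by rw [EuclideanSpace.norm_sq_eq]

theorem mul_eq_zero_of_conjTranspose_mul_mul_eq_zero {R : Matrix n n ℂ} (hR : R.PosSemidef)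
    {X : Matrix n m ℂ} (h : Xᴴ * R * X = 0) : R * X = 0 := by
  classical
  refine Matrix.ext_of_mulVec_single fun j => ?_
  rw [← Matrix.mulVec_mulVec, Matrix.zero_mulVec, ← hR.dotProduct_mulVec_zero_iff,
    Matrix.star_mulVec, ← Matrix.dotProduct_mulVec, Matrix.mulVec_mulVec, Matrix.mulVec_mulVec, h, Matrix.zero_mulVec, dotProduct_zero]

section SchurComplement

variable [DecidableEq m]

theorem pinv_isHermitian (H : Matrix m m ℂ) : (pinv H).IsHermitian :=
  cfc_predicate (p := IsSelfAdjoint) _ H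

/-- The range inclusion that makes the generalized Schur complement work: for psd `R` the columns
of `Eᴴ R` lie in the range of `Eᴴ R E`. -/
theorem mul_pinv_mul_compression {R : Matrix n n ℂ} (hR : R.PosSemidef) (E : Matrix n m ℂ) :
    Eᴴ * R * E * pinv (Eᴴ * R * E) * (Eᴴ * R) = Eᴴ * R := by
  set B := Eᴴ * R * E with hB
  have hBh : B.IsHermitian := (hR.conjTranspose_mul_mul_same E).isHermitian
  obtain ⟨h1, -, h3, -⟩ := pinv_isMoorePenrose B hBh
  have hX : R * (E * (1 - pinv B * B)) = 0 := by
    refine mul_eq_zero_of_conjTranspose_mul_mul_eq_zero hR ?_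
    calc (E * (1 - pinv B * B))ᴴ * R * (E * (1 - pinv B * B))
        = (1 - pinv B * B)ᴴ * (B - B * pinv B * B) := by
          rw [Matrix.conjTranspose_mul, hB]
          simp only [Matrix.mul_sub, Matrix.mul_one, Matrix.mul_assoc]
      _ = 0 := by rw [h1, sub_self, Matrix.mul_zero]
  have h4 := congrArg Matrix.conjTranspose hX
  rw [Matrix.conjTranspose_mul, Matrix.conjTranspose_mul, Matrix.conjTranspose_sub,
    Matrix.conjTranspose_mul, hBh.eq, (pinv_isHermitian B).eq, hR.isHermitian.eq,
    Matrix.conjTranspose_one, Matrix.conjTranspose_zero, Matrix.mul_assoc, Matrix.sub_mul,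
    Matrix.one_mul, sub_eq_zero] at h4
  exact h4.symm

variable [DecidableEq n]

/-- The matrix `1 - E (Eᴴ R E)† Eᴴ R`, which sends a vector to the representative of its class
modulo the range of `E` on which the quadratic form of `R` is least. -/
noncomputable def minimizer (R : Matrix n n ℂ) (E : Matrix n m ℂ) : Matrix n n ℂ :=
  1 - E * pinv (Eᴴ * R * E) * (Eᴴ * R)

theorem compression_mul_minimizer {R : Matrix n n ℂ} (hR : R.PosSemidef) (E : Matrix n m ℂ) :
    Eᴴ * R * minimizer R E = 0 := by
  rw [minimizer, Matrix.mul_sub, Matrix.mul_one, Matrix.mul_assoc E, ← Matrix.mul_assoc _ E,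
    ← Matrix.mul_assoc _ (pinv _), mul_pinv_mul_compression hR, sub_self]

theorem minimizer_conj {R : Matrix n n ℂ} (hR : R.PosSemidef) (E : Matrix n m ℂ) :
    (minimizer R E)ᴴ * R * minimizer R E = R * minimizer R E := by
  have h : (minimizer R E)ᴴ = 1 - R * E * pinv (Eᴴ * R * E) * Eᴴ := by
    simp only [minimizer, Matrix.conjTranspose_sub, Matrix.conjTranspose_mul,
      Matrix.conjTranspose_one, Matrix.conjTranspose_conjTranspose, hR.isHermitian.eq,
      (pinv_isHermitian _).eq, Matrix.mul_assoc]
  rw [h, Matrix.mul_assoc, Matrix.sub_mul, Matrix.one_mul]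
  have h2 : R * E * pinv (Eᴴ * R * E) * Eᴴ * (R * minimizer R E) =
      R * E * pinv (Eᴴ * R * E) * (Eᴴ * R * minimizer R E) := by
    simp only [Matrix.mul_assoc]
  rw [h2, compression_mul_minimizer hR, Matrix.mul_zero, sub_zero]

end SchurComplement

section Residual

variable [DecidableEq n]

theorem cholResidual_eq_mul_minimizer (R : Matrix n n ℂ) (S : Finset n) :
    cholResidual R S = R * minimizer R (coordInclusion S) := by
  have h1 : (coordInclusion S)ᴴ = (1 : Matrix n n ℂ).submatrix (fun s : S => (s : n)) id := by
    rw [coordInclusion, Matrix.conjTranspose_submatrix, Matrix.conjTranspose_one]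
  have h2 : (coordInclusion S)ᴴ * R = R.submatrix (fun s : S => (s : n)) id := by
    rw [h1]; ext; simp [Matrix.mul_apply, Matrix.one_apply]
  have h3 : R * coordInclusion S = R.submatrix id (fun s : S => (s : n)) := by
    ext; simp [coordInclusion, Matrix.mul_apply, Matrix.one_apply]
  have h4 : (coordInclusion S)ᴴ * R * coordInclusion S =
      R.submatrix (fun s : S => (s : n)) (fun s : S => (s : n)) := by
    rw [h2]; ext; simp [coordInclusion, Matrix.mul_apply, Matrix.one_apply]
  rw [minimizer, h4, h2, Matrix.mul_sub, Matrix.mul_one, ← Matrix.mul_assoc, ← Matrix.mul_assoc, h3,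
    cholResidual]

theorem cholResidual_posSemidef {R : Matrix n n ℂ} (hR : R.PosSemidef) (S : Finset n) :
    (cholResidual R S).PosSemidef := by
  rw [cholResidual_eq_mul_minimizer, ← minimizer_conj hR]
  exact hR.conjTranspose_mul_mul_same _

theorem quadForm_cholResidual {R : Matrix n n ℂ} (hR : R.PosSemidef) (S : Finset n) (v : n → ℂ) :
    quadForm (cholResidual R S) v = quadForm R (minimizer R (coordInclusion S) *ᵥ v) := by
  rw [cholResidual_eq_mul_minimizer, ← minimizer_conj hR, quadForm_conjTranspose_mul_mul]

/-- Changing a vector in the coordinates of `S` cannot bring the quadratic form of `R` below that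
of the residual. -/
theorem quadForm_cholResidual_le {R : Matrix n n ℂ} (hR : R.PosSemidef) {S : Finset n}
    {w : n → ℂ} (hw : ∀ i ∉ S, w i = 0) (v : n → ℂ) :
    quadForm (cholResidual R S) v ≤ quadForm R (v - w) := by
  rw [quadForm_cholResidual hR]
  set E := coordInclusion S
  set d : S → ℂ := (pinv (Eᴴ * R * E) * (Eᴴ * R)) *ᵥ v - fun s : S => w s with hd
  have h1 : v - w = minimizer R E *ᵥ v + E *ᵥ d := by
    rw [hd, Matrix.mulVec_sub, coordInclusion_mulVec_restrict hw, minimizer, Matrix.sub_mulVec,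
      Matrix.one_mulVec, Matrix.mulVec_mulVec, Matrix.mul_assoc]
    abel
  have h2 : star (E *ᵥ d) ⬝ᵥ R *ᵥ (minimizer R E *ᵥ v) = 0 := by
    rw [Matrix.star_mulVec, ← Matrix.dotProduct_mulVec, Matrix.mulVec_mulVec, Matrix.mulVec_mulVec,
      compression_mul_minimizer hR, Matrix.zero_mulVec, dotProduct_zero]
  rw [h1, quadForm_add hR.isHermitian, h2]
  have := quadForm_nonneg hR (E *ᵥ d)
  simpa using this

theorem exists_quadForm_cholResidual_eq {R : Matrix n n ℂ} (hR : R.PosSemidef) (S : Finset n)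
    (v : n → ℂ) :
    ∃ w : n → ℂ, (∀ i ∉ S, w i = 0) ∧ quadForm (cholResidual R S) v = quadForm R (v - w) := by
  refine ⟨coordInclusion S *ᵥ ((pinv ((coordInclusion S)ᴴ * R * coordInclusion S) *
    ((coordInclusion S)ᴴ * R)) *ᵥ v), fun i hi => coordInclusion_mulVec_apply_of_notMem _ hi, ?_⟩
  rw [quadForm_cholResidual hR, minimizer, Matrix.sub_mulVec, Matrix.one_mulVec,
    Matrix.mulVec_mulVec, Matrix.mul_assoc]

theorem quadForm_cholResidual_le_self {R : Matrix n n ℂ} (hR : R.PosSemidef) (S : Finset n)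
    (v : n → ℂ) : quadForm (cholResidual R S) v ≤ quadForm R v := by
  simpa using quadForm_cholResidual_le hR (S := S) (w := 0) (fun _ _ => rfl) v

theorem quadForm_cholResidual_anti {R : Matrix n n ℂ} (hR : R.PosSemidef) {S S' : Finset n}
    (h : S ⊆ S') (v : n → ℂ) :
    quadForm (cholResidual R S') v ≤ quadForm (cholResidual R S) v := by
  obtain ⟨w, hw, e⟩ := exists_quadForm_cholResidual_eq hR S v
  rw [e]
  exact quadForm_cholResidual_le hR (fun i hi => hw i fun hi' => hi (h hi')) v

theorem quadForm_cholResidual_insert_le {R : Matrix n n ℂ} (hR : R.PosSemidef) (S : Finset n)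
    (s : n) (c : ℂ) (v : n → ℂ) :
    quadForm (cholResidual R (insert s S)) v ≤
      quadForm (cholResidual R S) (v - Pi.single s c) := by
  obtain ⟨w, hw, e⟩ := exists_quadForm_cholResidual_eq hR S (v - Pi.single s c)
  rw [e, sub_sub]
  refine quadForm_cholResidual_le hR (fun i hi => ?_) v
  rw [Finset.mem_insert, not_or] at hi
  rw [Pi.add_apply, hw i hi.2, Pi.single_eq_of_ne hi.1, add_zero]

theorem quadForm_single (M : Matrix n n ℂ) (s : n) (c : ℂ) :
    quadForm M (Pi.single s c) = ‖c‖ ^ 2 * (M s s).re := by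
  rw [quadForm, ← Pi.single_star, single_dotProduct, Matrix.mulVec_single]
  simp only [Pi.smul_apply, Matrix.col_apply, MulOpposite.smul_eq_mul_unop, MulOpposite.unop_op]
  rw [mul_comm (M s s), ← mul_assoc, Complex.star_def, ← Complex.normSq_eq_conj_mul_self,
    Complex.re_ofReal_mul, Complex.normSq_eq_norm_sq]

theorem re_diag_eq_quadForm (M : Matrix n n ℂ) (s : n) :
    (M s s).re = quadForm M (Pi.single s 1) := by
  rw [quadForm_single]; simp

theorem mulVec_apply_eq_zero_of_diag_eq_zero {M : Matrix n n ℂ} (hM : M.PosSemidef) {s : n}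
    (h : (M s s).re = 0) (v : n → ℂ) : (M *ᵥ v) s = 0 := by
  have h0 : M s s = 0 := Complex.ext h (Complex.le_def.1 hM.diag_nonneg).2.symm
  have h1 : M *ᵥ Pi.single s 1 = 0 := by
    rw [← hM.dotProduct_mulVec_zero_iff]
    simp [h0]
  have h2 : (M *ᵥ v) s = star (Pi.single s 1 : n → ℂ) ⬝ᵥ M *ᵥ v := by
    simp
  rw [h2, Matrix.dotProduct_mulVec]
  have h3 : star (Pi.single s 1 : n → ℂ) ᵥ* M = star (M *ᵥ Pi.single s 1) := by
    rw [Matrix.star_mulVec, hM.isHermitian.eq]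
  rw [h3, h1, star_zero, zero_dotProduct]

/-- Accepting the pivot `s` lowers the quadratic form by at least `|(M v)_s|² / M(s,s)`, `M` being
the residual before.  The form without a quotient stays meaningful when `M(s,s) = 0`. -/
theorem diag_mul_quadForm_insert_le {R : Matrix n n ℂ} (hR : R.PosSemidef) (S : Finset n)
    (s : n) (v : n → ℂ) :
    (cholResidual R S s s).re * quadForm (cholResidual R (insert s S)) v ≤
      (cholResidual R S s s).re * quadForm (cholResidual R S) v -
        ‖(cholResidual R S *ᵥ v) s‖ ^ 2 := by
  have hM := cholResidual_posSemidef hR S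
  set M := cholResidual R S with hMdef
  rcases (re_diag_nonneg hM s).eq_or_lt with h0 | h0
  · rw [mulVec_apply_eq_zero_of_diag_eq_zero hM h0.symm v, ← h0]
    simp
  · set c : ℂ := (M *ᵥ v) s / ((M s s).re : ℂ) with hc
    have h1 := quadForm_cholResidual_insert_le hR S s c v
    rw [← hMdef, sub_eq_add_neg, ← Pi.single_neg, quadForm_add hM.isHermitian, quadForm_single,
      ← Pi.single_star, single_dotProduct] at h1
    have h2 : (star (-c) * (M *ᵥ v) s).re = -(‖(M *ᵥ v) s‖ ^ 2 / (M s s).re) := by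
      have : star (-c) * (M *ᵥ v) s = ((-(‖(M *ᵥ v) s‖ ^ 2 / (M s s).re) : ℝ) : ℂ) := by
        have e : star ((M *ᵥ v) s) * (M *ᵥ v) s = ((‖(M *ᵥ v) s‖ ^ 2 : ℝ) : ℂ) := by
          rw [← Complex.normSq_eq_norm_sq, Complex.normSq_eq_conj_mul_self]; rfl
        rw [hc, star_neg, star_div₀, show star ((M s s).re : ℂ) = ((M s s).re : ℂ) from Complex.conj_ofReal _,
          neg_mul, div_mul_eq_mul_div, e]
        push_cast
        rfl
      rw [this, Complex.ofReal_re]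
    have h3 : ‖-c‖ ^ 2 = ‖(M *ᵥ v) s‖ ^ 2 / (M s s).re ^ 2 := by
      rw [norm_neg, hc, norm_div, div_pow, Complex.norm_real, Real.norm_of_nonneg h0.le]
    rw [h2, h3] at h1
    calc (M s s).re * quadForm (cholResidual R (insert s S)) v
        ≤ _ := mul_le_mul_of_nonneg_left h1 h0.le
      _ = _ := by field_simp; ring

end Residual

/-! ### Partial traces -/

section PartialTrace

variable {ι : Type*}

/-- The sum of the quadratic form of `R` over the vectors `u i`, `i ∈ J`; for orthonormal vectors,
the trace of the compression of `R` to their span. -/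
def partialTrace (J : Finset ι) (u : ι → n → ℂ) (R : Matrix n n ℂ) : ℝ :=
  ∑ i ∈ J, quadForm R (u i)

theorem partialTrace_nonneg (J : Finset ι) (u : ι → n → ℂ) {R : Matrix n n ℂ}
    (hR : R.PosSemidef) : 0 ≤ partialTrace J u R :=
  Finset.sum_nonneg fun i _ => quadForm_nonneg hR (u i)

theorem partialTrace_mono (J : Finset ι) (u : ι → n → ℂ) {R R' : Matrix n n ℂ}
    (h : ∀ v, quadForm R v ≤ quadForm R' v) : partialTrace J u R ≤ partialTrace J u R' :=
  Finset.sum_le_sum fun i _ => h (u i)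

variable [DecidableEq n]

theorem partialTrace_univ_of_unitary {U : Matrix n n ℂ} (hU : U * Uᴴ = 1) (R : Matrix n n ℂ) :
    partialTrace Finset.univ (fun i => U.col i) R = R.trace.re := by
  have h : ∀ i, quadForm R (U.col i) = ((Uᴴ * R * U) i i).re := by
    intro i
    rw [re_diag_eq_quadForm, quadForm_conjTranspose_mul_mul, Matrix.mulVec_single_one]
  rw [partialTrace, Finset.sum_congr rfl fun i _ => h i, ← Complex.re_sum]
  change (Uᴴ * R * U).trace.re = _
  rw [Matrix.trace_mul_comm, ← Matrix.mul_assoc, hU, Matrix.one_mul]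

/-- The mean decrease of a partial trace in one proposal: weighted by the diagonal of the current
residual, the decreases add up to at least the square of the partial trace over `r`. -/
theorem sum_diag_mul_partialTrace_insert_le {R : Matrix n n ℂ} (hR : R.PosSemidef)
    (S : Finset n) {J : Finset ι} {u : ι → n → ℂ} (hu : ∀ i ∈ J, star (u i) ⬝ᵥ u i = 1)
    {r : ℝ} (hr : 0 < r) (hJ : (J.card : ℝ) ≤ r) :
    ∑ s, (cholResidual R S s s).re * (partialTrace J u (cholResidual R (insert s S)) -
        partialTrace J u (cholResidual R S)) ≤
      -(partialTrace J u (cholResidual R S) ^ 2 / r) := by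
  set M := cholResidual R S with hM
  have h1 : ∀ s, (M s s).re * (partialTrace J u (cholResidual R (insert s S)) -
      partialTrace J u M) ≤ -∑ i ∈ J, ‖(M *ᵥ u i) s‖ ^ 2 := by
    intro s
    rw [partialTrace, partialTrace, ← Finset.sum_sub_distrib, Finset.mul_sum,
      ← Finset.sum_neg_distrib]
    refine Finset.sum_le_sum fun i _ => ?_
    have := diag_mul_quadForm_insert_le hR S s (u i)
    rw [← hM] at this
    linarith
  calc _ ≤ ∑ s, -∑ i ∈ J, ‖(M *ᵥ u i) s‖ ^ 2 := Finset.sum_le_sum fun s _ => h1 s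
    _ = -∑ i ∈ J, ∑ s, ‖(M *ᵥ u i) s‖ ^ 2 := by
        rw [Finset.sum_neg_distrib, Finset.sum_comm]
    _ ≤ -∑ i ∈ J, quadForm M (u i) ^ 2 :=
        neg_le_neg (Finset.sum_le_sum fun i hi => quadForm_sq_le M (hu i hi))
    _ ≤ _ := by
        refine neg_le_neg ?_
        rw [div_le_iff₀ hr, partialTrace]
        have h2 := sq_sum_le_card_mul_sum_sq (s := J) (f := fun i => quadForm M (u i))
        have h3 : 0 ≤ ∑ i ∈ J, quadForm M (u i) ^ 2 := Finset.sum_nonneg fun i _ => sq_nonneg _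
        nlinarith

end PartialTrace

end LinearAlgebra

/-! ### The scalar recursion -/

section Scalar

/-- Tangent line of the concave function `x ↦ x C / (C + k x)` at `m`. -/
theorem harmonicDecay_le_tangent {C k y m : ℝ} (hC : 0 < C) (hk : 0 ≤ k) (hy : 0 ≤ y)
    (hm : 0 ≤ m) :
    y * C / (C + k * y) ≤ m * C / (C + k * m) + (C / (C + k * m)) ^ 2 * (y - m) := by
  have h1 : 0 < C + k * y := by positivity
  have h2 : 0 < C + k * m := by positivity
  rw [← sub_nonneg]
  have : m * C / (C + k * m) + (C / (C + k * m)) ^ 2 * (y - m) - y * C / (C + k * y) =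
      C ^ 2 * k * (y - m) ^ 2 / ((C + k * m) ^ 2 * (C + k * y)) := by
    field_simp; ring
  rw [this]; positivity

/-- One step `x ↦ x - x² / C` followed by the bound for `k` steps obeys the bound for `k + 1`
steps, because `x - x² / C ≤ x C / (C + x)`. -/
theorem harmonicDecay_step {C k x y : ℝ} (hC : 0 < C) (hk : 0 ≤ k) (hx : 0 ≤ x) (hy : 0 ≤ y)
    (h : y ≤ x - x ^ 2 / C) : y * C / (C + k * y) ≤ x * C / (C + (k + 1) * x) := by
  have h1 : 0 < C + k * y := by positivity
  have h2 : 0 < C + (k + 1) * x := by positivity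
  rw [div_le_div_iff₀ h1 h2]
  have h3 : y * C ≤ x * C - x ^ 2 := by
    have := mul_le_mul_of_nonneg_right h hC.le
    rwa [sub_mul, div_mul_cancel₀ _ hC.ne'] at this
  have h4 : y * (C + x) ≤ x * C := by
    have h5 : y * C * (C + x) ≤ (x * C - x ^ 2) * (C + x) :=
      mul_le_mul_of_nonneg_right h3 (by positivity)
    have h6 : 0 ≤ x ^ 3 := by positivity
    refine le_of_mul_le_mul_right ?_ hC
    nlinarith
  nlinarith

/-- The bound on the mean of `x` after one round, where `x + β` bounds the trace before. -/
noncomputable def roundMap (r b β x : ℝ) : ℝ :=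
  x * (r * (x + β)) / (r * (x + β) + b * x)

variable {r b β : ℝ}

theorem harmonicDecay_le_roundMap {x T : ℝ} (hr : 0 < r) (hb : 0 < b) (hβ : 0 < β) (hx : 0 ≤ x)
    (hT : 0 ≤ T) (h : T ≤ x + β) : x * (r * T) / (r * T + b * x) ≤ roundMap r b β x := by
  rcases hx.eq_or_lt with rfl | hx
  · simp [roundMap]
  · rw [roundMap, div_le_div_iff₀ (by positivity) (by positivity)]
    have : r * T * x * (b * x) ≤ r * (x + β) * x * (b * x) := by gcongr
    nlinarith

/-- `roundMap` is a lower envelope of affine functions, hence concave. -/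
theorem roundMap_le_affine {y : ℝ} (hr : 0 < r) (hb : 0 < b) (hβ : 0 < β) (hy : 0 ≤ y) (w : ℝ) :
    roundMap r b β y ≤ (1 - w) ^ 2 * y + w ^ 2 * (r * (y + β) / b) := by
  have h1 : 0 < r * (y + β) + b * y := by positivity
  rw [← sub_nonneg]
  have : (1 - w) ^ 2 * y + w ^ 2 * (r * (y + β) / b) - roundMap r b β y =
      ((1 - w) * (b * y) - w * (r * (y + β))) ^ 2 / (b * (r * (y + β) + b * y)) := by
    rw [roundMap]; field_simp; ring
  rw [this]; positivity

theorem roundMap_eq_affine {m : ℝ} (hr : 0 < r) (hb : 0 < b) (hβ : 0 < β) (hm : 0 ≤ m) :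
    roundMap r b β m = (1 - b * m / (r * (m + β) + b * m)) ^ 2 * m +
      (b * m / (r * (m + β) + b * m)) ^ 2 * (r * (m + β) / b) := by
  have h1 : 0 < r * (m + β) + b * m := by positivity
  rw [roundMap]; field_simp; ring

theorem roundMap_mono {x y : ℝ} (hr : 0 < r) (hb : 0 < b) (hβ : 0 < β) (hx : 0 ≤ x)
    (h : x ≤ y) : roundMap r b β x ≤ roundMap r b β y := by
  have hy := hx.trans h
  rw [roundMap_eq_affine hr hb hβ hy]
  refine (roundMap_le_affine hr hb hβ hx (b * y / (r * (y + β) + b * y))).trans ?_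
  gcongr

theorem roundMap_pos {x : ℝ} (hr : 0 < r) (hb : 0 < b) (hβ : 0 < β) (hx : 0 < x) :
    0 < roundMap r b β x := by
  rw [roundMap]; positivity

/-- The potential `(r + b) log x - r β / x`, an antiderivative of the reciprocal of the speed of
`dx/dt = - x² / (r (x + β) + b x)`, drops by at least `b` under `roundMap`. -/
theorem potential_roundMap_le {x : ℝ} (hr : 0 < r) (hb : 0 < b) (hβ : 0 < β) (hx : 0 < x) :
    (r + b) * Real.log (roundMap r b β x) - r * β / roundMap r b β x ≤
      (r + b) * Real.log x - r * β / x - b := by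
  set D := r * (x + β) with hD
  have hDpos : 0 < D := by positivity
  have hq : 0 < (D + b * x) / D := by positivity
  have hg : roundMap r b β x = x / ((D + b * x) / D) := by
    rw [roundMap, ← hD]; field_simp
  have hlog := Real.one_sub_inv_le_log_of_pos hq
  rw [hg, Real.log_div hx.ne' hq.ne']
  have h1 : r * β / (x / ((D + b * x) / D)) = r * β / x + b * β / (x + β) := by
    rw [hD]; field_simp
  have h2 : b * x / (x + β) ≤ (r + b) * (1 - ((D + b * x) / D)⁻¹) := by
    have e : (r + b) * (1 - ((D + b * x) / D)⁻¹) = (r + b) * (b * x) / (D + b * x) := by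
      field_simp; ring
    rw [e, div_le_div_iff₀ (by positivity) (by positivity), hD]
    have : 0 ≤ b * x * (b * β) := by positivity
    nlinarith
  have h3 : (r + b) * (1 - ((D + b * x) / D)⁻¹) ≤ (r + b) * Real.log ((D + b * x) / D) :=
    mul_le_mul_of_nonneg_left hlog (by positivity)
  have h4 : b * β / (x + β) + b * x / (x + β) = b := by field_simp; ring
  rw [h1]
  nlinarith

theorem recursion_le {ε : ℝ} (hr : 0 < r) (hb : 0 < b) (hβ : 0 < β) (hε : 0 < ε) {X : ℕ → ℝ}
    (hX : ∀ t, 0 ≤ X t) (h0 : 0 < X 0) (hstep : ∀ t, X (t + 1) ≤ roundMap r b β (X t)) {t : ℕ}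
    (ht : r / ε + (r + b) * Real.log (X 0 / (ε * β)) ≤ b * t) : X t ≤ ε * β := by
  set z : ℕ → ℝ := fun t => (roundMap r b β)^[t] (X 0) with hz
  have hzs : ∀ t, z (t + 1) = roundMap r b β (z t) := fun t =>
    Function.iterate_succ_apply' _ _ _
  have hzpos : ∀ t, 0 < z t := by
    intro t
    induction t with
    | zero => exact h0
    | succ t ih => rw [hzs]; exact roundMap_pos hr hb hβ ih
  have hXz : ∀ t, X t ≤ z t := by
    intro t
    induction t with
    | zero => exact le_rfl
    | succ t ih =>
      rw [hzs]
      exact (hstep t).trans (roundMap_mono hr hb hβ (hX t) ih)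
  have hpot : ∀ t : ℕ, (r + b) * Real.log (z t) - r * β / z t ≤
      (r + b) * Real.log (X 0) - r * β / X 0 - b * t := by
    intro t
    induction t with
    | zero => simp [hz]
    | succ t ih =>
      rw [hzs]
      have := potential_roundMap_le hr hb hβ (hzpos t)
      push_cast
      linarith
  refine (hXz t).trans ?_
  by_contra! hlt
  have hεβ : 0 < ε * β := by positivity
  have h1 : (r + b) * Real.log (ε * β) ≤ (r + b) * Real.log (z t) :=
    mul_le_mul_of_nonneg_left (Real.log_le_log hεβ hlt.le) (by positivity)
  have h2 : r * β / z t ≤ r / ε := by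
    rw [div_le_div_iff₀ (hzpos t) hε]
    nlinarith
  have h3 : 0 < r * β / X 0 := by positivity
  rw [Real.log_div h0.ne' hεβ.ne'] at ht
  have := hpot t
  nlinarith

end Scalar

/-! ### One round -/

section PivotLaw

variable {n : Type*} [Fintype n]

theorem tsum_diagWeight {R : Matrix n n ℂ} (hR : R.PosSemidef) :
    ∑' j, diagWeight R j = ENNReal.ofReal R.trace.re := by
  rw [tsum_fintype, Matrix.trace, Complex.re_sum]
  exact (ENNReal.ofReal_sum_of_nonneg fun j _ => re_diag_nonneg hR j).symm

theorem toReal_pivotLaw {R : Matrix n n ℂ} (hR : R.PosSemidef) (h : ∑' j, diagWeight R j ≠ 0)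
    (s : n) : (pivotLaw R h s).toReal = (R s s).re / R.trace.re := by
  have hT : 0 ≤ R.trace.re := (Complex.le_def.1 hR.trace_nonneg).1
  rw [pivotLaw, PMF.normalize_apply, tsum_diagWeight hR, ENNReal.toReal_mul, ENNReal.toReal_inv,
    ENNReal.toReal_ofReal hT, diagWeight, ENNReal.toReal_ofReal (re_diag_nonneg hR s),
    div_eq_mul_inv]

end PivotLaw

section Round

variable {n : Type*} [DecidableEq n]

theorem cholResidual_empty (R : Matrix n n ℂ) : cholResidual R ∅ = R := by
  ext i j
  simp [cholResidual, Matrix.mul_apply]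

theorem support_rejectionSample (R : Matrix n n ℂ) (l : List n) (S : Finset n) {S' : Finset n}
    (h : S' ∈ (rejectionSample R l S).support) : S' ⊆ S ∪ l.toFinset := by
  induction l generalizing S with
  | nil =>
    rw [rejectionSample, PMF.mem_support_pure_iff] at h
    simp [h]
  | cons s l ih =>
    rw [rejectionSample, PMF.mem_support_bind_iff] at h
    obtain ⟨a, -, ha⟩ := h
    refine (ih _ ha).trans ?_
    rw [List.toFinset_cons]
    intro i
    cases a <;> (simp; try tauto)

variable [Fintype n]

theorem diag_mul_acceptProb {R : Matrix n n ℂ} (hR : R.PosSemidef) (S : Finset n) (s : n) :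
    (R s s).re * (acceptProb R S s : ℝ) = (cholResidual R S s s).re := by
  have h1 := re_diag_nonneg (cholResidual_posSemidef hR S) s
  have h2 : (cholResidual R S s s).re ≤ (R s s).re := by
    rw [re_diag_eq_quadForm, re_diag_eq_quadForm R]
    exact quadForm_cholResidual_le_self hR S _
  rcases (re_diag_nonneg hR s).eq_or_lt with h0 | h0
  · rw [← h0, zero_mul]
    linarith
  · rw [acceptProb, NNReal.coe_min, NNReal.coe_one, Real.coe_toNNReal _ (div_nonneg h1 h0.le),
      min_eq_right ((div_le_one h0).2 h2), mul_div_cancel₀ _ h0.ne']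

theorem expect_coin_comm {α : Type*} {q : PMF α} (hq : q.support.Finite) (p : ℝ≥0) (hp : p ≤ 1)
    (F : α → Bool → ℝ) :
    (expect q fun l => expect (coin p hp) fun a => F l a) =
      expect (coin p hp) fun a => expect q fun l => F l a := by
  simp only [expect_coin]
  rw [expect_add hq]
  have h := fun c a => expect_affine hq (fun l => F l a) c 0
  simp only [add_zero] at h
  rw [h, h]

theorem expect_rejectionSample_cons (R : Matrix n n ℂ) (s : n) (l : List n) (S : Finset n)
    (f : Finset n → ℝ) :
    expect (rejectionSample R (s :: l) S) f =
      expect (coin (acceptProb R S s) (min_le_left _ _)) fun a =>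
        expect (rejectionSample R l (if a then insert s S else S)) f := by
  rw [rejectionSample, expect_bind (Set.toFinite _) fun a _ => Set.toFinite _]

/-- Rejection makes the law of an accepted pivot proportional to the diagonal of the current
residual, while the normalization stays the trace at the beginning of the round. -/
theorem expect_proposal {R : Matrix n n ℂ} (hR : R.PosSemidef) (h : ∑' j, diagWeight R j ≠ 0)
    (S : Finset n) (f : Finset n → ℝ) :
    (expect (pivotLaw R h) fun s => expect (coin (acceptProb R S s) (min_le_left _ _)) fun a =>
        f (if a then insert s S else S)) =
      f S + (∑ s, (cholResidual R S s s).re * (f (insert s S) - f S)) / R.trace.re := by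
  have h1 : ∀ s, (expect (coin (acceptProb R S s) (min_le_left _ _)) fun a =>
      f (if a then insert s S else S)) = (acceptProb R S s : ℝ) * (f (insert s S) - f S) + f S := by
    intro s
    refine (expect_coin _ _ _).trans ?_
    simp only [if_true, Bool.false_eq_true, if_false]
    ring
  have h2 := expect_affine (p := pivotLaw R h) (Set.toFinite _)
    (fun s => (acceptProb R S s : ℝ) * (f (insert s S) - f S)) 1 (f S)
  simp only [one_mul] at h2
  simp only [h1, h2]
  rw [add_comm, expect, tsum_fintype, Finset.sum_div]
  congr 1
  refine Finset.sum_congr rfl fun s _ => ?_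
  rw [toReal_pivotLaw hR, ← diag_mul_acceptProb hR S s]
  ring

/-- The effect of `k` proposals of accelerated RPCholesky on the mean of a partial trace `x` over
at most `r` orthonormal directions: it is at most `x C / (C + k x)`, where `C` is `r` times the
trace at the beginning of the round. -/
theorem expect_rejectionSample_le {R : Matrix n n ℂ} (hR : R.PosSemidef)
    (h : ∑' j, diagWeight R j ≠ 0) {ι : Type*} {J : Finset ι} {u : ι → n → ℂ}
    (hu : ∀ i ∈ J, star (u i) ⬝ᵥ u i = 1) {r : ℝ} (hr : 0 < r) (hJ : (J.card : ℝ) ≤ r)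
    (k : ℕ) (S : Finset n) :
    (expect (iidDraws (pivotLaw R h) k) fun l => expect (rejectionSample R l S) fun S' =>
        partialTrace J u (cholResidual R S')) ≤
      partialTrace J u (cholResidual R S) * (r * R.trace.re) /
        (r * R.trace.re + k * partialTrace J u (cholResidual R S)) := by
  have hT : 0 < R.trace.re := by
    rw [tsum_diagWeight hR] at h
    exact ENNReal.ofReal_pos.1 (pos_iff_ne_zero.2 h)
  set C := r * R.trace.re with hC
  have hCpos : 0 < C := mul_pos hr hT
  set f : Finset n → ℝ := fun S' => partialTrace J u (cholResidual R S') with hf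
  have hf0 : ∀ S', 0 ≤ f S' := fun S' => partialTrace_nonneg J u (cholResidual_posSemidef hR S')
  change (expect (iidDraws (pivotLaw R h) k) fun l => expect (rejectionSample R l S) f) ≤
    f S * C / (C + k * f S)
  induction k generalizing S with
  | zero =>
    simp only [iidDraws, rejectionSample, expect_pure, Nat.cast_zero, zero_mul, add_zero]
    rw [mul_div_cancel_right₀ _ hCpos.ne']
  | succ k ih =>
    set m := expect (pivotLaw R h) fun s => expect (coin (acceptProb R S s) (min_le_left _ _))
      fun a => f (if a then insert s S else S) with hm
    have hm0 : 0 ≤ m := expect_nonneg fun s _ => expect_nonneg fun a _ => hf0 _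
    have hmle : m ≤ f S - f S ^ 2 / C := by
      rw [hm, expect_proposal hR h S f]
      have h1 := div_le_div_of_nonneg_right
        (sum_diag_mul_partialTrace_insert_le hR S hu hr hJ) hT.le
      have h2 : -(f S ^ 2 / r) / R.trace.re = -(f S ^ 2 / C) := by
        rw [hC]; field_simp
      rw [h2] at h1
      linarith
    have hfin : ∀ l S', (rejectionSample R l S').support.Finite := fun _ _ => Set.toFinite _
    rw [expect_iidDraws_succ]
    simp only [expect_rejectionSample_cons]
    set σ := (C / (C + k * m)) ^ 2 with hσ
    calc _ = expect (pivotLaw R h) fun s => expect (coin (acceptProb R S s) (min_le_left _ _))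
          fun a => expect (iidDraws (pivotLaw R h) k) fun l =>
            expect (rejectionSample R l (if a then insert s S else S)) f := by
          congr 1
          funext s
          exact expect_coin_comm (finite_support_iidDraws _ _) _ _ _
      -- Jensen's inequality for the concave bound on the last `k` proposals, by its tangent at `m`
      _ ≤ expect (pivotLaw R h) fun s => expect (coin (acceptProb R S s) (min_le_left _ _))
          fun a => σ * f (if a then insert s S else S) + (m * C / (C + k * m) - σ * m) := by
          refine expect_mono (Set.toFinite _) fun s _ => expect_mono (Set.toFinite _) fun a _ => ?_
          refine (ih _).trans ?_
          have := harmonicDecay_le_tangent hCpos (Nat.cast_nonneg k)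
            (hf0 (if a then insert s S else S)) hm0
          rw [← hσ] at this
          linarith
      _ = m * C / (C + k * m) := by
          have h3 := fun s => expect_affine (p := coin (acceptProb R S s) (min_le_left _ _))
            (Set.toFinite _) (fun a => f (if a then insert s S else S)) σ
            (m * C / (C + k * m) - σ * m)
          simp only [h3]
          rw [expect_affine (Set.toFinite _), ← hm]
          ring
      _ ≤ f S * C / (C + ((k + 1 : ℕ) : ℝ) * f S) := by
          rw [Nat.cast_succ]
          exact harmonicDecay_step hCpos (Nat.cast_nonneg k) (hf0 S) hm0 hmle

theorem quadForm_eq_zero_of_trace_eq_zero {R : Matrix n n ℂ} (hR : R.PosSemidef)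
    (h : R.trace.re = 0) (v : n → ℂ) : quadForm R v = 0 := by
  have hs : ∀ s, (R s s).re = 0 := by
    rw [Matrix.trace, Complex.re_sum] at h
    exact fun s => (Finset.sum_eq_zero_iff_of_nonneg fun j _ => re_diag_nonneg hR j).1 h s
      (Finset.mem_univ s)
  rw [quadForm, funext fun s => mulVec_apply_eq_zero_of_diag_eq_zero hR (hs s) v]
  change (star v ⬝ᵥ 0).re = 0
  rw [dotProduct_zero, Complex.zero_re]

/-- What the analysis over many rounds needs from the Markov kernel `K` of one round with `b`
proposals: it moves psd matrices down in the Loewner order, and it lowers the mean of the partial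
trace over at most `r` unit vectors at the rate given by `decay`. -/
structure IsDecayingRound (b : ℕ) (K : Matrix n n ℂ → PMF (Matrix n n ℂ)) : Prop where
  finite_support : ∀ R, (K R).support.Finite
  posSemidef : ∀ ⦃R⦄, R.PosSemidef → ∀ R' ∈ (K R).support, R'.PosSemidef
  quadForm_le : ∀ ⦃R⦄, R.PosSemidef → ∀ R' ∈ (K R).support, ∀ v, quadForm R' v ≤ quadForm R v
  decay : ∀ ⦃R⦄, R.PosSemidef → ∀ (J : Finset n) (u : n → n → ℂ),
    (∀ i ∈ J, star (u i) ⬝ᵥ u i = 1) → ∀ r : ℝ, 0 < r → (J.card : ℝ) ≤ r →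
      expect (K R) (partialTrace J u) ≤
        partialTrace J u R * (r * R.trace.re) / (r * R.trace.re + b * partialTrace J u R)

theorem expect_pure_partialTrace_le {R : Matrix n n ℂ} (hR : R.PosSemidef)
    (h : ¬∑' j, diagWeight R j ≠ 0) (J : Finset n) (u : n → n → ℂ) (r : ℝ) (b : ℕ) :
    expect (PMF.pure R) (partialTrace J u) ≤
      partialTrace J u R * (r * R.trace.re) / (r * R.trace.re + b * partialTrace J u R) := by
  rw [not_not, tsum_diagWeight hR, ENNReal.ofReal_eq_zero] at h
  have hT : R.trace.re = 0 := le_antisymm h (Complex.le_def.1 hR.trace_nonneg).1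
  have h0 : partialTrace J u R = 0 :=
    Finset.sum_eq_zero fun i _ => quadForm_eq_zero_of_trace_eq_zero hR hT (u i)
  rw [expect_pure, h0]
  simp

theorem support_acceleratedRound {b : ℕ} {R R' : Matrix n n ℂ}
    (h : R' ∈ (acceleratedRound b R).support) : ∃ S, R' = cholResidual R S := by
  rw [acceleratedRound] at h
  split_ifs at h
  · simp only [PMF.mem_support_bind_iff, PMF.mem_support_map_iff] at h
    obtain ⟨_, _, S, _, rfl⟩ := h
    exact ⟨S, rfl⟩
  · exact ⟨∅, by rw [cholResidual_empty, (PMF.mem_support_pure_iff _ _).1 h]⟩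

theorem support_blockRound {b : ℕ} {R R' : Matrix n n ℂ}
    (h : R' ∈ (blockRound b R).support) : ∃ S, R' = cholResidual R S := by
  rw [blockRound] at h
  split_ifs at h
  · rw [PMF.mem_support_map_iff] at h
    obtain ⟨l, _, rfl⟩ := h
    exact ⟨l.toFinset, rfl⟩
  · exact ⟨∅, by rw [cholResidual_empty, (PMF.mem_support_pure_iff _ _).1 h]⟩

theorem finite_support_of_residual {p : PMF (Matrix n n ℂ)} {R : Matrix n n ℂ}
    (h : ∀ R' ∈ p.support, ∃ S, R' = cholResidual R S) : p.support.Finite :=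
  (Set.finite_range (cholResidual R)).subset fun R' hR' => by
    obtain ⟨S, rfl⟩ := h R' hR'
    exact ⟨S, rfl⟩

theorem isDecayingRound_acceleratedRound (b : ℕ) :
    IsDecayingRound b (acceleratedRound (n := n) b) where
  finite_support R := finite_support_of_residual fun R' => support_acceleratedRound
  posSemidef R hR R' h := by
    obtain ⟨S, rfl⟩ := support_acceleratedRound h
    exact cholResidual_posSemidef hR S
  quadForm_le R hR R' h v := by
    obtain ⟨S, rfl⟩ := support_acceleratedRound h
    exact quadForm_cholResidual_le_self hR S v
  decay R hR J u hu r hr hJ := by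
    rw [acceleratedRound]
    split_ifs with h
    · have hfin := finite_support_iidDraws (pivotLaw R h) b
      rw [expect_bind hfin fun l _ => finite_support_map (Set.toFinite _) _]
      simp only [expect_map (Set.toFinite (rejectionSample R _ ∅).support)]
      simpa only [cholResidual_empty] using expect_rejectionSample_le hR h hu hr hJ b ∅
    · exact expect_pure_partialTrace_le hR h J u r b

/-- Block RPCholesky keeps more pivots than accelerated RPCholesky with the same proposals, so its
residual is smaller, and the bound for one round carries over. -/
theorem isDecayingRound_blockRound (b : ℕ) : IsDecayingRound b (blockRound (n := n) b) where
  finite_support R := finite_support_of_residual fun R' => support_blockRound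
  posSemidef R hR R' h := by
    obtain ⟨S, rfl⟩ := support_blockRound h
    exact cholResidual_posSemidef hR S
  quadForm_le R hR R' h v := by
    obtain ⟨S, rfl⟩ := support_blockRound h
    exact quadForm_cholResidual_le_self hR S v
  decay R hR J u hu r hr hJ := by
    rw [blockRound]
    split_ifs with h
    · have hfin := finite_support_iidDraws (pivotLaw R h) b
      rw [expect_map hfin]
      refine le_trans ?_ (by
        simpa only [cholResidual_empty] using expect_rejectionSample_le hR h hu hr hJ b ∅)
      refine expect_mono hfin fun l _ => ?_
      rw [← expect_const (p := rejectionSample R l ∅) (Set.toFinite _)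
        (partialTrace J u (cholResidual R l.toFinset))]
      refine expect_mono (Set.toFinite _) fun S' hS' => partialTrace_mono J u fun v =>
        quadForm_cholResidual_anti hR ?_ v
      simpa using support_rejectionSample R l ∅ hS'
    · exact expect_pure_partialTrace_le hR h J u r b

end Round

/-! ### Many rounds -/

section Rounds

variable {n : Type*} [Fintype n]

namespace IsDecayingRound

variable {b : ℕ} {K : Matrix n n ℂ → PMF (Matrix n n ℂ)} {A : Matrix n n ℂ}
  {law : ℕ → PMF (Matrix n n ℂ)}

theorem support_law (hK : IsDecayingRound b K) (hA : A.PosSemidef) (h0 : law 0 = PMF.pure A)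
    (hs : ∀ t, law (t + 1) = (law t).bind K) (t : ℕ) :
    (law t).support.Finite ∧
      ∀ R ∈ (law t).support, R.PosSemidef ∧ ∀ v, quadForm R v ≤ quadForm A v := by
  induction t with
  | zero =>
    rw [h0, PMF.support_pure]
    refine ⟨Set.finite_singleton A, ?_⟩
    rintro R rfl
    exact ⟨hA, fun v => le_rfl⟩
  | succ t ih =>
    rw [hs]
    refine ⟨finite_support_bind ih.1 fun R _ => hK.finite_support R, fun R' hR' => ?_⟩
    obtain ⟨R, hR, hRR'⟩ := (PMF.mem_support_bind_iff _ _ _).1 hR'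
    obtain ⟨hpsd, hle⟩ := ih.2 R hR
    exact ⟨hK.posSemidef hpsd R' hRR', fun v => (hK.quadForm_le hpsd R' hRR' v).trans (hle v)⟩

variable [DecidableEq n]

/-- One round for the mean of the leading partial trace: since the complementary partial trace
never exceeds its initial value `β`, the trace in the rate of `decay` is at most `x + β`, and
concavity of `roundMap` allows passing to the mean. -/
theorem expect_partialTrace_succ_le (hK : IsDecayingRound b K) (hA : A.PosSemidef)
    (h0 : law 0 = PMF.pure A) (hs : ∀ t, law (t + 1) = (law t).bind K) (hb : 0 < b)
    {U : Matrix n n ℂ} (hU : U * Uᴴ = 1) {J : Finset n} {r β : ℝ} (hr : 0 < r)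
    (hJ : (J.card : ℝ) ≤ r) (hβ : 0 < β)
    (hAβ : partialTrace Jᶜ (fun i => U.col i) A ≤ β) (t : ℕ) :
    expect (law (t + 1)) (partialTrace J fun i => U.col i) ≤
      roundMap r b β (expect (law t) (partialTrace J fun i => U.col i)) := by
  obtain ⟨hfin, hsupp⟩ := hK.support_law hA h0 hs t
  set x : Matrix n n ℂ → ℝ := partialTrace J fun i => U.col i with hx
  have hb' : (0 : ℝ) < b := Nat.cast_pos.2 hb
  have hu : ∀ i ∈ J, star (U.col i) ⬝ᵥ U.col i = 1 := by
    intro i _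
    have h1 : (Uᴴ * U) i i = 1 := by rw [mul_eq_one_comm.1 hU, Matrix.one_apply_eq]
    exact h1
  have hx0 : ∀ R ∈ (law t).support, 0 ≤ x R := fun R hR => partialTrace_nonneg _ _ (hsupp R hR).1
  set m := expect (law t) x with hm
  have hm0 : 0 ≤ m := expect_nonneg hx0
  set w := b * m / (r * (m + β) + b * m) with hw
  rw [hs, expect_bind hfin fun R _ => hK.finite_support R]
  calc expect (law t) (fun R => expect (K R) x)
      ≤ expect (law t) fun R => ((1 - w) ^ 2 + w ^ 2 * (r / b)) * x R + w ^ 2 * (r * β / b) := by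
        refine expect_mono hfin fun R hR => ?_
        obtain ⟨hpsd, hle⟩ := hsupp R hR
        have hT : R.trace.re ≤ x R + β := by
          rw [← partialTrace_univ_of_unitary hU R, partialTrace, ← Finset.sum_add_sum_compl J]
          exact add_le_add le_rfl ((partialTrace_mono Jᶜ _ hle).trans hAβ)
        have h1 := hK.decay hpsd J (fun i => U.col i) hu r hr hJ
        have h2 := harmonicDecay_le_roundMap hr hb' hβ (hx0 R hR)
          (Complex.le_def.1 hpsd.trace_nonneg).1 hT
        have h3 := roundMap_le_affine hr hb' hβ (hx0 R hR) w
        refine (h1.trans (h2.trans h3)).trans_eq ?_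
        ring
    _ = roundMap r b β m := by
        rw [expect_affine hfin, ← hm, roundMap_eq_affine hr hb' hβ hm0, ← hw]
        ring

end IsDecayingRound

variable [DecidableEq n]

/-- The indices of the `r` largest eigenvalues, in the numbering of `eigenvectorBasis`. -/
noncomputable def leadingIndices (n : Type*) [Fintype n] [DecidableEq n] (r : ℕ) : Finset n :=
  Finset.univ.filter fun i =>
    ((Fintype.equivOfCardEq (Fintype.card_fin (Fintype.card n)) :
      Fin (Fintype.card n) ≃ n).symm i : ℕ) < r

theorem card_leadingIndices_le (r : ℕ) : (leadingIndices n r).card ≤ r := by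
  rw [← Finset.card_range r]
  refine Finset.card_le_card_of_injOn (fun i =>
    ((Fintype.equivOfCardEq (Fintype.card_fin (Fintype.card n)) :
      Fin (Fintype.card n) ≃ n).symm i : ℕ)) (fun i hi => ?_) fun i _ j _ h => ?_
  · simpa [leadingIndices] using hi
  · exact Equiv.injective _ (Fin.val_injective h)

variable {A : Matrix n n ℂ}

theorem quadForm_eigenvectorUnitary_col (hA : A.IsHermitian) (i : n) :
    quadForm A ((hA.eigenvectorUnitary : Matrix n n ℂ).col i) = hA.eigenvalues i := by
  rw [hA.eigenvalues_eq i]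
  rfl

theorem partialTrace_leadingIndices (hA : A.IsHermitian) (r : ℕ) :
    partialTrace (leadingIndices n r)
      (fun i => (hA.eigenvectorUnitary : Matrix n n ℂ).col i) A = headSum hA r := by
  simp only [partialTrace, quadForm_eigenvectorUnitary_col, leadingIndices, headSum,
    Finset.sum_filter]
  exact Equiv.sum_comp (Fintype.equivOfCardEq (Fintype.card_fin (Fintype.card n))).symm
    fun i : Fin (Fintype.card n) => if (i : ℕ) < r then hA.eigenvalues₀ i else 0

theorem partialTrace_compl_leadingIndices (hA : A.IsHermitian) (r : ℕ) :
    partialTrace (leadingIndices n r)ᶜ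
      (fun i => (hA.eigenvectorUnitary : Matrix n n ℂ).col i) A = tailSum hA r := by
  simp only [partialTrace, quadForm_eigenvectorUnitary_col, leadingIndices, tailSum,
    Finset.compl_filter, not_lt, Finset.sum_filter]
  exact Equiv.sum_comp (Fintype.equivOfCardEq (Fintype.card_fin (Fintype.card n))).symm
    fun i : Fin (Fintype.card n) => if r ≤ (i : ℕ) then hA.eigenvalues₀ i else 0

theorem headSum_pos (hA : A.PosSemidef) {r : ℕ} (hr : 0 < r)
    (hβ : 0 < tailSum hA.isHermitian r) : 0 < headSum hA.isHermitian r := by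
  have hnn : ∀ i, 0 ≤ hA.isHermitian.eigenvalues₀ i := by
    intro i
    have := hA.eigenvalues_nonneg (Fintype.equivOfCardEq (Fintype.card_fin _) i)
    rwa [Matrix.IsHermitian.eigenvalues, Equiv.symm_apply_apply] at this
  obtain ⟨i, hi, hpos⟩ := Finset.exists_lt_of_sum_lt (f := fun _ => (0 : ℝ))
    (lt_of_eq_of_lt Finset.sum_const_zero hβ)
  have hcard : 0 < Fintype.card n := i.pos
  refine Finset.sum_pos' (fun j _ => hnn j) ⟨⟨0, hcard⟩, by simpa using hr, ?_⟩
  exact lt_of_lt_of_le hpos (hA.isHermitian.eigenvalues₀_antitone (Fin.mk_le_of_le_val (Nat.zero_le _)))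

/-- The bound on the expected trace for any sequence of laws driven by a decaying round.  The
leading partial trace contributes at most `ε β` by `recursion_le`, the complementary one at most
its initial value `β`, the sum of the trailing eigenvalues. -/
theorem IsDecayingRound.expectedTrace_le {b : ℕ} {K : Matrix n n ℂ → PMF (Matrix n n ℂ)}
    (hK : IsDecayingRound b K) (hA : A.PosSemidef) {law : ℕ → PMF (Matrix n n ℂ)}
    (h0 : law 0 = PMF.pure A) (hs : ∀ t, law (t + 1) = (law t).bind K) (hb : 0 < b) {t r : ℕ}
    {ε : ℝ} (hε : 0 < ε) (hβ : 0 < tailSum hA.isHermitian r)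
    (hbt : (r : ℝ) / ε + ((r : ℝ) + (b : ℝ)) *
      Real.log (headSum hA.isHermitian r / (ε * tailSum hA.isHermitian r)) ≤ b * t) :
    TraceIntegrable (law t) ∧ expectedTrace (law t) ≤ (1 + ε) * tailSum hA.isHermitian r := by
  set β := tailSum hA.isHermitian r with hβdef
  set U : Matrix n n ℂ := (hA.isHermitian.eigenvectorUnitary : Matrix n n ℂ) with hUdef
  have hU : U * Uᴴ = 1 := Unitary.coe_mul_star_self _
  set J := leadingIndices n r with hJdef
  have hAβ : partialTrace Jᶜ (fun i => U.col i) A = β :=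
    partialTrace_compl_leadingIndices hA.isHermitian r
  obtain ⟨hfin, hsupp⟩ := hK.support_law hA h0 hs t
  refine ⟨summable_of_finite_support hfin _, ?_⟩
  have hhead : expect (law t) (partialTrace J fun i => U.col i) ≤ ε * β := by
    rcases Nat.eq_zero_or_pos r with rfl | hr
    -- there is no leading direction, and monotonicity of the residuals alone gives the bound
    · have hJ0 : J = ∅ := Finset.card_eq_zero.1 (Nat.le_zero.1 (card_leadingIndices_le 0))
      rw [hJ0]
      change expect (law t) (fun _ => 0) ≤ ε * β
      rw [expect_const hfin]
      positivity
    · refine recursion_le (X := fun t => expect (law t) (partialTrace J fun i => U.col i))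
        (Nat.cast_pos.2 hr) (Nat.cast_pos.2 hb) hβ hε (fun t => expect_nonneg fun R hR =>
          partialTrace_nonneg _ _ ((hK.support_law hA h0 hs t).2 R hR).1) ?_
        (hK.expect_partialTrace_succ_le hA h0 hs hb hU (Nat.cast_pos.2 hr)
          (Nat.cast_le.2 (card_leadingIndices_le r)) hβ hAβ.le) ?_
      · rw [h0, expect_pure, partialTrace_leadingIndices]
        exact headSum_pos hA hr hβ
      · rw [h0, expect_pure, partialTrace_leadingIndices]
        exact hbt
  calc expectedTrace (law t)
      ≤ expect (law t) fun R => 1 * partialTrace J (fun i => U.col i) R + β := by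
        refine expect_mono hfin fun R hR => ?_
        rw [← partialTrace_univ_of_unitary hU R, partialTrace, ← Finset.sum_add_sum_compl J,
          one_mul]
        exact add_le_add le_rfl ((partialTrace_mono Jᶜ _ (hsupp R hR).2).trans_eq hAβ)
    _ = expect (law t) (partialTrace J fun i => U.col i) + β := by
        rw [expect_affine hfin, one_mul]
    _ ≤ (1 + ε) * β := by linarith

end Rounds

end RPCholesky

theorem mainTheorem1 (N : ℕ) (A : Matrix (Fin N) (Fin N) ℂ) (hA : A.PosSemidef)
    (b t r : ℕ) (hb : 1 ≤ b) (ε : ℝ) (hε : 0 < ε) (η : ℝ)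
    (hβ : 0 < RPCholesky.tailSum hA.isHermitian r)
    (hη : η = RPCholesky.tailSum hA.isHermitian r / RPCholesky.headSum hA.isHermitian r)
    (hbt : (r : ℝ) / ε + ((r : ℝ) + (b : ℝ)) * Real.log (1 / (ε * η)) ≤ (b : ℝ) * (t : ℝ)) :
    (RPCholesky.TraceIntegrable (RPCholesky.acceleratedLaw A b t) ∧
      RPCholesky.expectedTrace (RPCholesky.acceleratedLaw A b t)
        ≤ (1 + ε) * RPCholesky.tailSum hA.isHermitian r) ∧
    (RPCholesky.TraceIntegrable (RPCholesky.blockLaw A b t) ∧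
      RPCholesky.expectedTrace (RPCholesky.blockLaw A b t)
        ≤ (1 + ε) * RPCholesky.tailSum hA.isHermitian r) := by
  -- for `r = 0` the head sum, `η` and the logarithm all vanish by Lean's conventions, and the
  -- condition on `b t` reads `0 ≤ b t`
  rw [hη, ← mul_div_assoc, one_div_div] at hbt
  exact ⟨(RPCholesky.isDecayingRound_acceleratedRound b).expectedTrace_le hA rfl (fun _ => rfl) hb
      hε hβ hbt,
    (RPCholesky.isDecayingRound_blockRound b).expectedTrace_le hA rfl (fun _ => rfl) hb hε hβ hbt⟩
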